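/- Let $k\in\{1,2,\dots,\infty\}$, let $G$ be a $C^k$ Lie group (finite-dimensional, Hausdorff, second countable) acting on $\mathbb{R}^n$ through a $C^k$ map $G\times\mathbb{R}^n\to\mathbb{R}^n$, $(g,x)\mapsto gx$, and let $f:\mathbb{R}^n\to\mathbb{R}\cup\{\infty\}$ be $G$-invariant, i.e. $f(gx)=f(x)$ for all $g\in G$, $x\in\mathbb{R}^n$. Let $\overline{x}$ satisfy $f(\overline{x})<\infty$, and suppose that the action is typical at $\overline{x}$: (i) there is an open neighborhood $U$ of $\overline{x}$ such that $\{g\in G: U\cap gU\neq\emptyset\}$ has compact closure; (ii) for all $x$ near $\overline{x}$, the isotropy group $G_x=\{g\in G: gx=x\}$ is conjugate in $G$ to $G_{\overline{x}}$. If $f(x)$ is finite, let $\widehat\partial f(x)$ be the set of $v\in\mathbb{R}^n$ with $f(y)\ge f(x)+\langle v,y-x\rangle+o(|y-x|)$ for $y$ near $x$; let $\widehat\partial f(x)=\emptyset$ otherwise. Let $\partial f(\overline{x})$ be the set of limits $v=\lim v_i$, and $\partial^\infty f(\overline{x})$ the set of limits $v=\lim\tau_iv_i$ with $\tau_i>0$,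 $\tau_i\to0$, where in both cases $v_i\in\widehat\partial f(x_i)$, $x_i\to\overline{x}$ and $f(x_i)\to f(\overline{x})$. Let $P$ be the orthogonal projection of $\mathbb{R}^n$ onto the tangent space $T_{\overline{x}}G\overline{x}\subseteq\mathbb{R}^n$ of the orbit $G\overline{x}$ at $\overline{x}$, i.e. the space of velocities at $\overline{x}$ of $C^k$ curves in $\mathbb{R}^n$ through $\overline{x}$ that stay in $G\overline{x}$. Then $$P\,\partial f(\overline{x})\subseteq\{0\}\qquad\text{and}\qquad P\,\partial^\infty f(\overline{x})\subseteq\{0\},$$ and if moreover $f$ is lower semicontinuous on a neighborhood of $\overline{x}$, then $P\,\partial^\infty f(\overline{x})=\{0\}$. -/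

import Mathlib

open Filter Topology Set
open scoped Manifold ContDiff

noncomputable section

/-! ### Subdifferentials of extended real-valued functions -/

/-- The regular subdifferential of `f` at `x`: empty if `f x` is not finite; otherwise the vectors
`v` with `f y ≥ f x + ⟪v, y - x⟫ + o(‖y - x‖)` for `y` near `x`. -/
def regularSubdifferential {E : Type*} [NormedAddCommGroup E] [InnerProductSpace ℝ E]
    (f : E → EReal) (x : E) : Set E :=
  {v | f x ≠ ⊥ ∧ f x ≠ ⊤ ∧ ∀ ε : ℝ, 0 < ε → ∀ᶠ y in 𝓝 x,
    (((f x).toReal + inner ℝ v (y - x) - ε * ‖y - x‖ : ℝ) : EReal) ≤ f y}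

/-- The (limiting) subdifferential of `f` at `x`. -/
def limitingSubdifferential {E : Type*} [NormedAddCommGroup E] [InnerProductSpace ℝ E]
    (f : E → EReal) (x : E) : Set E :=
  {v | f x ≠ ⊥ ∧ f x ≠ ⊤ ∧ ∃ xs vs : ℕ → E,
    (∀ i, vs i ∈ regularSubdifferential f (xs i)) ∧
    Tendsto xs atTop (𝓝 x) ∧ Tendsto (fun i => f (xs i)) atTop (𝓝 (f x)) ∧
    Tendsto vs atTop (𝓝 v)}

/-- The horizon subdifferential of `f` at `x`. -/
def horizonSubdifferential {E : Type*} [NormedAddCommGroup E] [InnerProductSpace ℝ E]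
    (f : E → EReal) (x : E) : Set E :=
  {v | f x ≠ ⊥ ∧ f x ≠ ⊤ ∧ ∃ (xs vs : ℕ → E) (τ : ℕ → ℝ),
    (∀ i, vs i ∈ regularSubdifferential f (xs i)) ∧
    (∀ i, 0 < τ i) ∧ Tendsto τ atTop (𝓝 0) ∧
    Tendsto xs atTop (𝓝 x) ∧ Tendsto (fun i => f (xs i)) atTop (𝓝 (f x)) ∧
    Tendsto (fun i => τ i • vs i) atTop (𝓝 v)}

/-! ### Actions -/

/-- The action of `G` on `M` is proper near `x`: for some open neighborhood `U` of `x`, the set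
`{g | U ∩ gU ≠ ∅}` has compact closure. -/
def ProperActionNear (G : Type*) {M : Type*} [Group G] [TopologicalSpace G] [TopologicalSpace M]
    [MulAction G M] (x : M) : Prop :=
  ∃ U : Set M, IsOpen U ∧ x ∈ U ∧
    IsCompact (closure {g : G | (U ∩ (fun y => g • y) '' U).Nonempty})

/-- The type of the orbit of `x`: the conjugacy class in `G` of the isotropy group of `x`. -/
def orbitType (G : Type*) {M : Type*} [Group G] [MulAction G M] (x : M) : Set (Subgroup G) :=
  {H | ∃ g : G, H = (MulAction.stabilizer G x).map (MulAut.conj g).toMonoidHom}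

/-- The action of `G` on `M` is typical at `x`: it is proper near `x` and the orbit type is
constant near `x`. -/
def TypicalActionAt (G : Type*) {M : Type*} [Group G] [TopologicalSpace G] [TopologicalSpace M]
    [MulAction G M] (x : M) : Prop :=
  ProperActionNear G x ∧ ∀ᶠ y in 𝓝 x, orbitType G y = orbitType G x

/-! ### Tangent spaces -/

/-- The velocities at `x` of the `C^k` curves through `x` that stay in `S`. -/
def curveVelocities {E : Type*} [NormedAddCommGroup E] [NormedSpace ℝ E]
    (k : ℕ∞) (S : Set E) (x : E) : Set E :=
  {w | ∃ (γ : ℝ → E) (ε : ℝ), 0 < ε ∧ ContDiffOn ℝ k γ (Ioo (-ε) ε) ∧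
    (∀ t ∈ Ioo (-ε) ε, γ t ∈ S) ∧ γ 0 = x ∧ HasDerivAt γ w 0}

/-- The tangent space at `x` of a `C^k` submanifold `S` of a normed space, as a subspace of the
ambient space. For a submanifold the velocities of the curves in `S` already form a linear
subspace; the span only serves to bundle it as a `Submodule`. -/
def submanifoldTangentSpace {E : Type*} [NormedAddCommGroup E] [NormedSpace ℝ E]
    (k : ℕ∞) (S : Set E) (x : E) : Submodule ℝ E :=
  Submodule.span ℝ (curveVelocities k S x)

end

/-! A regular subgradient of `f` at `x` is orthogonal to every curve through `x` on which `f` is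
constant, hence to the range of the derivative at the identity of `g ↦ g • x`: the infinitesimal
generators at `x`. These depend continuously on `x`, so orthogonality survives limits of (scaled)
subgradients (`inner_fderiv_orbit_eq_zero_of_tendsto`).

It remains to see that the velocity of any curve in the orbit is a generator
(`curveVelocities_orbit_subset`). Properness lets points of the curve near `x` be written as `g • x`
with `g` tending to the identity along a subsequence, after correction by a stabilizer element.
Since the orbit map has maximal rank at the identity, its image near there is a graph over the space
of generators, which forces the velocity into that space.

For the equality, penalized minimization produces regular subgradients near `x₀`; small multiples of
them tend to `0`. -/

/-! ### Constant rank and velocities -/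

/-- A form of the constant rank theorem: a `C^1` map whose rank does not exceed its rank at `a`
factors, near `a`, through the orthogonal projection onto the range of its derivative at `a`. -/
theorem ContDiffAt.exists_factor_of_rank_le {E F : Type*} [NormedAddCommGroup E] [NormedSpace ℝ E]
    [FiniteDimensional ℝ E] [NormedAddCommGroup F] [InnerProductSpace ℝ F] [FiniteDimensional ℝ F]
    {φ : E → F} {a : E} (hφ : ContDiffAt ℝ 1 φ a)
    {T : Submodule ℝ F} (hT : (fderiv ℝ φ a).range = T)
    (hrank : ∀ᶠ u in 𝓝 a, Module.finrank ℝ (fderiv ℝ φ u).range ≤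
      Module.finrank ℝ T) :
    ∃ (s : T → F) (s' : T →L[ℝ] F),
      HasFDerivAt s s' (T.orthogonalProjectionOnto (φ a)) ∧
      (∀ x, s' x ∈ T) ∧
      ∀ᶠ u in 𝓝 a, φ u = s (T.orthogonalProjectionOnto (φ u)) := by
  have : CompleteSpace E := FiniteDimensional.complete ℝ E
  set P : F →L[ℝ] T := T.orthogonalProjectionOnto with hP
  set ψ : E → T := fun u => P (φ u) with hψ
  have hφ1 : HasStrictFDerivAt φ (fderiv ℝ φ a) a := hφ.hasStrictFDerivAt one_ne_zero
  have hψ1 : HasStrictFDerivAt ψ (P.comp (fderiv ℝ φ a)) a := P.hasStrictFDerivAt.comp a hφ1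
  have hsurj : (P.comp (fderiv ℝ φ a)).range = ⊤ := by
    rw [eq_top_iff]
    rintro ⟨t, ht⟩ -
    have ht' := ht
    rw [← hT] at ht'
    obtain ⟨e, he⟩ := ht'
    refine ⟨e, ?_⟩
    have he' : fderiv ℝ φ a e = t := he
    change P (fderiv ℝ φ a e) = _
    rw [he', hP]
    exact Submodule.orthogonalProjectionOnto_mem_subspace_eq_self (K := T) ⟨t, ht⟩
  have hker : (P.comp (fderiv ℝ φ a)).ker.ClosedComplemented :=
    Submodule.ClosedComplemented.of_finiteDimensional _
  -- `Ψ` straightens `ψ`: its first coordinate is `ψ`, its second a projection onto the kernel. In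
  -- these coordinates `φ` becomes `h`, with `P (h (t, n)) = t`.
  set D := hψ1.implicitFunctionDataOfComplemented ψ _ hsurj hker with hD
  set Ψ := D.toOpenPartialHomeomorph with hΨ
  have hΨa : Ψ a = (ψ a, 0) := by
    exact hψ1.implicitToOpenPartialHomeomorphOfComplemented_self hsurj hker
  have has : a ∈ Ψ.source := D.pt_mem_toOpenPartialHomeomorph_source
  have hΨs : Ψ.symm (Ψ a) = a := Ψ.left_inv has
  have hcd : ContDiffAt ℝ 1 Ψ a := by
    have h1 : ContDiffAt ℝ 1 ψ a := P.contDiff.contDiffAt.comp a hφ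
    have h2 : ContDiffAt ℝ 1 D.rightFun a := by
      change ContDiffAt ℝ 1 (fun x => Classical.choose hker (x - a)) a
      exact (ContinuousLinearMap.contDiff _).contDiffAt.comp a (contDiffAt_id.sub contDiffAt_const)
    exact h1.prodMk h2
  have hg : ContDiffAt ℝ 1 Ψ.symm (Ψ a) := by
    refine Ψ.contDiffAt_symm (f₀' := D.leftDeriv.equivProdOfSurjectiveOfIsCompl D.rightDeriv
      D.range_leftDeriv D.range_rightDeriv D.isCompl_ker) (Ψ.map_source has) ?_ (by rwa [hΨs])
    · rw [hΨs]; exact D.hasStrictFDerivAt.hasFDerivAt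
  have hgt : Tendsto Ψ.symm (𝓝 (Ψ a)) (𝓝 a) := by
    have := hg.continuousAt.tendsto
    rwa [hΨs] at this
  have hφe : ∀ᶠ u in 𝓝 a, ContDiffAt ℝ 1 φ u := hφ.eventually (by simp)
  have hev : ∀ᶠ p in 𝓝 (Ψ a), ContDiffAt ℝ 1 Ψ.symm p ∧ Ψ (Ψ.symm p) = p ∧
      ContDiffAt ℝ 1 φ (Ψ.symm p) ∧
      Module.finrank ℝ (fderiv ℝ φ (Ψ.symm p)).range ≤ Module.finrank ℝ T :=
    (hg.eventually (by simp)).and ((Ψ.eventually_right_inverse (Ψ.map_source has)).and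
      ((hgt.eventually hφe).and (hgt.eventually hrank)))
  obtain ⟨δ, hδ, hball⟩ := Metric.eventually_nhds_iff_ball.1 hev
  set h : T × _ → F := fun p => φ (Ψ.symm p) with hh
  have hder : ∀ p ∈ Metric.ball (Ψ a) δ, DifferentiableAt ℝ h p := fun p hp =>
    ((hball p hp).2.2.1.differentiableAt one_ne_zero).comp p
      ((hball p hp).1.differentiableAt one_ne_zero)
  have hPh : ∀ p ∈ Metric.ball (Ψ a) δ, P (h p) = p.1 := fun p hp =>
    congrArg Prod.fst (hball p hp).2.1
  -- `P` maps the range of `fderiv ℝ φ` onto `T`; by the rank bound it is injective there. It kills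
  -- the image of `(0, n)`, which is therefore zero.
  have hzero : ∀ p ∈ Metric.ball (Ψ a) δ, ∀ n, fderiv ℝ h p (0, n) = 0 := by
    intro p hp n
    have h1 : P.comp (fderiv ℝ h p) = ContinuousLinearMap.fst ℝ _ _ := by
      have e1 : HasFDerivAt (fun q => P (h q)) (P.comp (fderiv ℝ h p)) p :=
        P.hasFDerivAt.comp p (hder p hp).hasFDerivAt
      refine e1.unique (HasFDerivAt.congr_of_eventuallyEq hasFDerivAt_fst ?_)
      filter_upwards [Metric.isOpen_ball.mem_nhds hp] with q hq using hPh q hq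
    have h2 : fderiv ℝ h p = (fderiv ℝ φ (Ψ.symm p)).comp (fderiv ℝ Ψ.symm p) :=
      fderiv_comp p ((hball p hp).2.2.1.differentiableAt one_ne_zero)
        ((hball p hp).1.differentiableAt one_ne_zero)
    set R : Submodule ℝ F := (fderiv ℝ φ (Ψ.symm p)).range with hR
    have hmem : ∀ q, fderiv ℝ h p q ∈ R := fun q => by rw [h2]; exact ⟨_, rfl⟩
    have hsj : Function.Surjective ((P : F →ₗ[ℝ] T).domRestrict R) := by
      intro t
      refine ⟨⟨fderiv ℝ h p (t, 0), hmem _⟩, ?_⟩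
      exact congrArg (fun f => f (t, 0)) h1
    have hinj : Function.Injective ((P : F →ₗ[ℝ] T).domRestrict R) := by
      rw [LinearMap.injective_iff_surjective_of_finrank_eq_finrank]
      · exact hsj
      · exact le_antisymm (hball p hp).2.2.2 (LinearMap.finrank_le_finrank_of_surjective hsj)
    have h3 : (⟨fderiv ℝ h p (0, n), hmem _⟩ : R) = 0 := by
      apply hinj
      rw [map_zero]
      exact congrArg (fun f => f (0, n)) h1
    exact congrArg Subtype.val h3
  have hconst : ∀ t n, (t, n) ∈ Metric.ball (Ψ a) δ → h (t, n) = h (t, 0) := by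
    intro t n htn
    rw [hΨa, ← ball_prod_same] at htn
    have h0 : (0 : (P.comp (fderiv ℝ φ a)).ker) ∈ Metric.ball 0 δ := Metric.mem_ball_self hδ
    have hm : ∀ n' ∈ Metric.ball (0 : (P.comp (fderiv ℝ φ a)).ker) δ,
        (t, n') ∈ Metric.ball (Ψ a) δ := fun n' hn' => by
      rw [hΨa, ← ball_prod_same]; exact ⟨htn.1, hn'⟩
    have hd : ∀ n' ∈ Metric.ball (0 : (P.comp (fderiv ℝ φ a)).ker) δ,
        HasFDerivWithinAt (fun n' => h (t, n')) (0 : (P.comp (fderiv ℝ φ a)).ker →L[ℝ] F)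
          (Metric.ball 0 δ) n' := by
      intro n' hn'
      have e := (hder _ (hm n' hn')).hasFDerivAt.comp n' (hasFDerivAt_prodMk_right t n')
      refine (e.congr_fderiv ?_).hasFDerivWithinAt
      refine ContinuousLinearMap.ext fun v => ?_
      exact hzero _ (hm n' hn') v
    have := (convex_ball (0 : (P.comp (fderiv ℝ φ a)).ker) δ).norm_image_sub_le_of_norm_hasFDerivWithin_le
      (C := 0) hd (fun _ _ => norm_zero.le) h0 htn.2
    simpa [sub_eq_zero] using this
  have hb : ((ψ a, 0) : T × (P.comp (fderiv ℝ φ a)).ker) ∈ Metric.ball (Ψ a) δ := by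
    rw [hΨa]; exact Metric.mem_ball_self hδ
  refine ⟨fun t => h (t, 0), (fderiv ℝ h (ψ a, 0)).comp (ContinuousLinearMap.inl ℝ _ _), ?_, ?_, ?_⟩
  · exact HasFDerivAt.comp (f := fun t : T => (t, (0 : (P.comp (fderiv ℝ φ a)).ker))) (ψ a)
      (hder _ hb).hasFDerivAt (hasFDerivAt_prodMk_left (ψ a) _)
  · intro x
    have h2 : fderiv ℝ h (ψ a, 0) =
        (fderiv ℝ φ (Ψ.symm (ψ a, 0))).comp (fderiv ℝ Ψ.symm (ψ a, 0)) :=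
      fderiv_comp _ ((hball _ hb).2.2.1.differentiableAt one_ne_zero)
        ((hball _ hb).1.differentiableAt one_ne_zero)
    -- The base point `(ψ a, 0)` is `Ψ a`, so the derivative of `h` there factors through that of
    -- `φ` at `a`.
    have h3 : ∀ y, fderiv ℝ φ a y ∈ T := fun y => hT ▸ ⟨y, rfl⟩
    rw [h2, ← hΨa, hΨs]
    exact h3 _
  · have hΨc : ContinuousAt Ψ a := Ψ.continuousAt has
    filter_upwards [Ψ.eventually_left_inverse has,
      hΨc.eventually (Metric.isOpen_ball.mem_nhds (Metric.mem_ball_self hδ))] with u h1 h2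
    have : φ u = h (Ψ u) := by simp only [hh]; rw [h1]
    rw [this]
    change h (Ψ u) = h (P (h (Ψ u)), 0)
    rw [hPh _ h2]
    exact hconst _ _ h2

/-- The velocity of a curve meeting, along a sequence of times tending to `0`, the image of a map
of locally constant rank lies in the range of the derivative of that map. -/
theorem ContDiffAt.velocity_mem_of_rank_le {E F : Type*} [NormedAddCommGroup E] [NormedSpace ℝ E]
    [FiniteDimensional ℝ E] [NormedAddCommGroup F] [InnerProductSpace ℝ F] [FiniteDimensional ℝ F]
    {φ : E → F} {a : E} (hφ : ContDiffAt ℝ 1 φ a) {T : Submodule ℝ F}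
    (hT : (fderiv ℝ φ a).range = T)
    (hrank : ∀ᶠ u in 𝓝 a, Module.finrank ℝ (fderiv ℝ φ u).range ≤ Module.finrank ℝ T)
    {γ : ℝ → F} {w : F} (hγ : HasDerivAt γ w 0) (hγ0 : γ 0 = φ a)
    {us : ℕ → E} (hus : Tendsto us atTop (𝓝 a)) {t : ℕ → ℝ} (ht : Tendsto t atTop (𝓝[≠] 0))
    (he : ∀ᶠ i in atTop, φ (us i) = γ (t i)) : w ∈ T := by
  obtain ⟨s, s', hs, hs'T, hev⟩ := hφ.exists_factor_of_rank_le hT hrank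
  -- This difference vanishes at `0` and, eventually, at every `t i`, so its derivative is `0`.
  -- Hence `w = s' (P w)`, with `P` the projection onto `T`.
  have hd : HasDerivAt (fun r => γ r - s (T.orthogonalProjectionOnto (γ r)))
      (w - s' (T.orthogonalProjectionOnto w)) 0 := by
    refine hγ.sub ?_
    rw [← hγ0] at hs
    exact hs.comp_hasDerivAt 0 (T.orthogonalProjectionOnto.hasFDerivAt.comp_hasDerivAt 0 hγ)
  have h0 : γ 0 - s (T.orthogonalProjectionOnto (γ 0)) = 0 := by
    rw [hγ0, sub_eq_zero]; exact hev.self_of_nhds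
  have hlim := (hasDerivAt_iff_tendsto_slope.1 hd).comp ht
  have hzero : Tendsto (fun _ : ℕ => (0 : F)) atTop
      (𝓝 (w - s' (T.orthogonalProjectionOnto w))) := by
    refine hlim.congr' ?_
    filter_upwards [he, hus.eventually hev] with i h1 h2
    simp only [Function.comp, slope_def_module, h0]
    rw [← h1, ← h2]
    simp
  have := tendsto_nhds_unique hzero tendsto_const_nhds
  rw [sub_eq_zero.1 this]
  exact hs'T _

/-! ### Rank of the orbit map and tangent vectors to orbits -/

section Orbit

variable {E V G : Type*} [NormedAddCommGroup E] [NormedSpace ℝ E]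
  [NormedAddCommGroup V] [InnerProductSpace ℝ V]
  [Group G] [TopologicalSpace G] [ChartedSpace E G] [LieGroup 𝓘(ℝ, E) 1 G]
  [MulAction G V] [ContMDiffSMul 𝓘(ℝ, E) 𝓘(ℝ, V) 1 G V]

/-- A `C^1` action is `C^1` when read in the chart at the identity. -/
theorem contDiffAt_extChartAt_symm_smul {u : E} (hu : u ∈ (extChartAt 𝓘(ℝ, E) (1 : G)).target)
    (x : V) :
    ContDiffAt ℝ 1 (fun p : E × V => (extChartAt 𝓘(ℝ, E) (1 : G)).symm p.1 • p.2) (u, x) := by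
  have : IsManifold 𝓘(ℝ, E) 1 G := LieGroup.toContMDiffMul.toIsManifold
  rw [← contMDiffAt_iff_contDiffAt]
  refine ContMDiffAt.smul (I := 𝓘(ℝ, E)) ?_ contDiffAt_snd.contMDiffAt
  have h1 : ContMDiffAt 𝓘(ℝ, E) 𝓘(ℝ, E) 1 (extChartAt 𝓘(ℝ, E) (1 : G)).symm u :=
    (contMDiffOn_extChartAt_symm (1 : G)).contMDiffAt ((isOpen_extChartAt_target _).mem_nhds hu)
  exact h1.comp (u, x) contDiffAt_fst.contMDiffAt

theorem contDiffAt_extChartAt_symm_smul_left {u : E}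
    (hu : u ∈ (extChartAt 𝓘(ℝ, E) (1 : G)).target) (x : V) :
    ContDiffAt ℝ 1 (fun v => (extChartAt 𝓘(ℝ, E) (1 : G)).symm v • x) u :=
  (contDiffAt_extChartAt_symm_smul hu x).comp u (contDiffAt_id.prodMk contDiffAt_const)

/-- The orbit map, read in the chart at the identity, has its largest rank at the identity. -/
theorem finrank_range_fderiv_orbit_le [FiniteDimensional ℝ E] [FiniteDimensional ℝ V] {u : E}
    (hu : u ∈ (extChartAt 𝓘(ℝ, E) (1 : G)).target) (x : V) :
    Module.finrank ℝ (fderiv ℝ (fun v => (extChartAt 𝓘(ℝ, E) (1 : G)).symm v • x) u).range ≤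
      Module.finrank ℝ (fderiv ℝ (fun v => (extChartAt 𝓘(ℝ, E) (1 : G)).symm v • x)
        (extChartAt 𝓘(ℝ, E) (1 : G) 1)).range := by
  have : IsManifold 𝓘(ℝ, E) 1 G := LieGroup.toContMDiffMul.toIsManifold
  set c := extChartAt 𝓘(ℝ, E) (1 : G) with hc
  set φ : E → V := fun v => c.symm v • x with hφ
  set a := c.symm u with ha
  set β : E → E := fun v => c (a⁻¹ * c.symm v) with hβ
  have hau : a⁻¹ * c.symm u = 1 := inv_mul_cancel _
  have hβu : β u = c 1 := by simp only [hβ, hau]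
  have h1 : ContMDiffAt 𝓘(ℝ, E) 𝓘(ℝ, E) 1 c.symm u :=
    (contMDiffOn_extChartAt_symm (1 : G)).contMDiffAt ((isOpen_extChartAt_target _).mem_nhds hu)
  have h2 : ContMDiffAt 𝓘(ℝ, E) 𝓘(ℝ, E) 1 (fun v => a⁻¹ * c.symm v) u :=
    (contMDiff_mul_left (I := 𝓘(ℝ, E)) (n := 1) (a := a⁻¹)).contMDiffAt.comp u h1
  have hβd : DifferentiableAt ℝ β u := by
    have h3 : ContMDiffAt 𝓘(ℝ, E) 𝓘(ℝ, E) 1 c (a⁻¹ * c.symm u) := by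
      rw [hau]
      exact contMDiffAt_extChartAt
    exact (h3.comp u h2).contDiffAt.differentiableAt one_ne_zero
  have hφd : DifferentiableAt ℝ φ (β u) := by
    rw [hβu]
    exact (contDiffAt_extChartAt_symm_smul_left (mem_extChartAt_target _) x).differentiableAt
      one_ne_zero
  have had : DifferentiableAt ℝ (fun y : V => a • y) (φ (β u)) :=
    (ContMDiffSMul.contMDiff_const_smul (I := 𝓘(ℝ, E)) (I' := 𝓘(ℝ, V)) (n := 1)
      a).contDiff.contDiffAt.differentiableAt one_ne_zero
  -- Equivariance: left translation by `a⁻¹` carries a neighborhood of `a` to one of the identity,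
  -- so the rank at `u` is bounded by the rank at `c 1`.
  have heq : φ =ᶠ[𝓝 u] fun v => a • φ (β v) := by
    have hmem : ∀ᶠ v in 𝓝 u, a⁻¹ * c.symm v ∈ c.source := by
      refine h2.continuousAt.eventually ?_
      change c.source ∈ 𝓝 (a⁻¹ * c.symm u)
      rw [hau]
      exact extChartAt_source_mem_nhds _
    filter_upwards [hmem] with v hv
    simp only [hφ, hβ]
    rw [c.left_inv hv, mul_smul, smul_inv_smul]
  have hder : fderiv ℝ φ u = (fderiv ℝ (fun y : V => a • y) (φ (β u))).comp
      ((fderiv ℝ φ (β u)).comp (fderiv ℝ β u)) := by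
    rw [heq.fderiv_eq]
    have e := had.hasFDerivAt.comp u (hφd.hasFDerivAt.comp u hβd.hasFDerivAt)
    exact e.fderiv
  rw [hder, ← hβu]
  set A : V →ₗ[ℝ] V := (fderiv ℝ (fun y : V => a • y) (φ (β u))).toLinearMap
  calc _ ≤ Module.finrank ℝ ((fderiv ℝ φ (β u)).range.map A) := by
        refine Submodule.finrank_mono ?_
        rintro _ ⟨y, rfl⟩
        exact ⟨_, ⟨_, rfl⟩, rfl⟩
    _ ≤ _ := Submodule.finrank_map_le _ _

/-- If the action is proper near `x`, velocities of curves in the orbit of `x` are infinitesimal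
generators of the action at `x`. -/
theorem curveVelocities_orbit_subset [FiniteDimensional ℝ E] [FiniteDimensional ℝ V]
    [SecondCountableTopology G] {k : ℕ∞} {x : V} (hx : ProperActionNear G x) :
    curveVelocities k (MulAction.orbit G x) x ⊆
      (fderiv ℝ (fun v => (extChartAt 𝓘(ℝ, E) (1 : G)).symm v • x)
        (extChartAt 𝓘(ℝ, E) (1 : G) 1)).range := by
  rintro w ⟨γ, ε, hε, -, hmem, hγ0, hγ⟩
  have : IsTopologicalGroup G := topologicalGroup_of_lieGroup 𝓘(ℝ, E) 1
  have : ContinuousSMul G V := ContMDiffSMul.continuousSMul (I := 𝓘(ℝ, E)) (I' := 𝓘(ℝ, V)) 1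
  obtain ⟨U, hU, hxU, hcomp⟩ := hx
  have hev : ∀ᶠ t in 𝓝 (0 : ℝ), t ∈ Ioo (-ε) ε ∧ γ t ∈ U :=
    (show ∀ᶠ t in 𝓝 (0 : ℝ), t ∈ Ioo (-ε) ε from Ioo_mem_nhds (neg_neg_iff_pos.2 hε) hε).and
      (hγ.continuousAt.eventually (by rw [hγ0]; exact hU.mem_nhds hxU))
  obtain ⟨t, ht⟩ : ∃ t : ℕ → ℝ, Tendsto t atTop (𝓝[≠] 0) := exists_seq_tendsto _
  have ht0 : Tendsto t atTop (𝓝 0) := ht.mono_right nhdsWithin_le_nhds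
  obtain ⟨N, hN⟩ := eventually_atTop.1 (ht0.eventually hev)
  have hg : ∀ i, ∃ g : G, g • x = γ (t (i + N)) := fun i => hmem _ (hN _ (by omega)).1
  choose g hg using hg
  have hgK : ∀ i, g i ∈ closure {g : G | (U ∩ (fun y => g • y) '' U).Nonempty} := fun i =>
    subset_closure ⟨γ (t (i + N)), (hN _ (by omega)).2, x, hxU, hg i⟩
  have htN : Tendsto (fun i => t (i + N)) atTop (𝓝[≠] 0) := ht.comp (tendsto_add_atTop_nat N)
  obtain ⟨b, -, j, hj, hb⟩ := hcomp.tendsto_subseq hgK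
  have hγlim : Tendsto (fun i => γ (t (j i + N))) atTop (𝓝 x) := by
    have h1 := hγ.continuousAt.tendsto.comp
      ((htN.mono_right nhdsWithin_le_nhds).comp hj.tendsto_atTop)
    rwa [hγ0] at h1
  have hbx : b • x = x := by
    refine tendsto_nhds_unique ?_ hγlim
    simp only [← hg]
    exact hb.smul_const x
  -- Since `b` fixes `x`, right multiplication by `b⁻¹` leaves the orbit points unchanged and moves
  -- the group elements into the chart at the identity.
  have hlim : Tendsto (fun i => g (j i) * b⁻¹) atTop (𝓝 1) := by
    have := hb.mul_const b⁻¹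
    rwa [mul_inv_cancel] at this
  refine ContDiffAt.velocity_mem_of_rank_le
    (contDiffAt_extChartAt_symm_smul_left (mem_extChartAt_target _) x) rfl ?_ hγ ?_
    ((continuousAt_extChartAt (1 : G)).tendsto.comp hlim) (htN.comp hj.tendsto_atTop) ?_
  · filter_upwards [extChartAt_target_mem_nhds (1 : G)] with u hu
    exact finrank_range_fderiv_orbit_le hu x
  · rw [hγ0, extChartAt_to_inv, one_smul]
  · filter_upwards [hlim.eventually (extChartAt_source_mem_nhds (I := 𝓘(ℝ, E)) (1 : G))] with i hi
    simp only [Function.comp]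
    rw [(extChartAt 𝓘(ℝ, E) (1 : G)).left_inv hi, mul_smul, inv_smul_eq_iff.2 hbx.symm, hg]

end Orbit

/-! ### Regular subgradients: orthogonality and existence -/

section Subdifferential

variable {V : Type*} [NormedAddCommGroup V] [InnerProductSpace ℝ V] {f : V → EReal} {x v w : V}

/-- Along `η` the values of `f` cancel in the subgradient inequality; divide by `t > 0`, let `t →
0`, then `ε → 0`. Reversing the curve gives the opposite sign. -/
theorem regularSubdifferential.inner_nonpos (hv : v ∈ regularSubdifferential f x) {η : ℝ → V}
    (hη : HasDerivAt η w 0) (hη0 : η 0 = x) (hf : ∀ᶠ t in 𝓝 0, f (η t) = f x) :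
    inner ℝ v w ≤ 0 := by
  obtain ⟨hb, ht, hsub⟩ := hv
  have key : ∀ ε : ℝ, 0 < ε → inner ℝ v w ≤ ε * ‖w‖ := by
    intro ε hε
    have hslope : Tendsto (slope η 0) (𝓝[>] 0) (𝓝 w) :=
      (hasDerivAt_iff_tendsto_slope.1 hη).mono_left
        (nhdsWithin_mono _ fun t (h : 0 < t) => h.ne')
    have hev : ∀ᶠ t in 𝓝 (0 : ℝ),
        (((f x).toReal + inner ℝ v (η t - x) - ε * ‖η t - x‖ : ℝ) : EReal) ≤ f (η t) := by
      have := hη.continuousAt.tendsto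
      rw [hη0] at this
      exact this.eventually (hsub ε hε)
    refine le_of_tendsto_of_tendsto (tendsto_const_nhds.inner hslope) (hslope.norm.const_mul ε) ?_
    filter_upwards [hev.filter_mono nhdsWithin_le_nhds, hf.filter_mono nhdsWithin_le_nhds,
      self_mem_nhdsWithin] with t h1 h2 (h3 : 0 < t)
    rw [h2, ← EReal.coe_toReal ht hb, EReal.coe_le_coe_iff, EReal.toReal_coe] at h1
    have h4 : inner ℝ v (η t - x) ≤ ε * ‖η t - x‖ := by linarith
    rw [slope_def_module, hη0, sub_zero, inner_smul_right, norm_smul, Real.norm_of_nonneg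
      (inv_nonneg.2 h3.le), mul_left_comm]
    exact mul_le_mul_of_nonneg_left h4 (inv_nonneg.2 h3.le)
  have hlim : Tendsto (fun ε : ℝ => ε * ‖w‖) (𝓝[>] 0) (𝓝 0) := by
    have : Tendsto (fun ε : ℝ => ε * ‖w‖) (𝓝 0) (𝓝 (0 * ‖w‖)) := tendsto_id.mul_const _
    rw [zero_mul] at this
    exact this.mono_left nhdsWithin_le_nhds
  exact ge_of_tendsto hlim (eventually_mem_nhdsWithin.mono key)

/-- Regular subgradients are orthogonal to curves along which the function is constant. -/
theorem regularSubdifferential.inner_eq_zero (hv : v ∈ regularSubdifferential f x) {η : ℝ → V}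
    (hη : HasDerivAt η w 0) (hη0 : η 0 = x) (hf : ∀ᶠ t in 𝓝 0, f (η t) = f x) :
    inner ℝ v w = 0 := by
  refine le_antisymm (regularSubdifferential.inner_nonpos hv hη hη0 hf) ?_
  have hη' : HasDerivAt (fun t => η (-t)) (-w) 0 := by
    have h1 : HasDerivAt η w (-0) := by rwa [neg_zero]
    simpa [Function.comp_def] using h1.scomp 0 (hasDerivAt_neg (0 : ℝ))
  have hneg : Tendsto (fun t : ℝ => -t) (𝓝 0) (𝓝 0) := by
    simpa using (continuous_neg (G := ℝ)).tendsto 0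
  have := regularSubdifferential.inner_nonpos hv hη' (by simpa using hη0) (hneg.eventually hf)
  rw [inner_neg_right] at this
  linarith

/-- Near a point of lower semicontinuity in the domain of a function there are points with regular
subgradients and nearby values. -/
theorem exists_seq_regularSubdifferential [FiniteDimensional ℝ V] (hbot : ∀ y, f y ≠ ⊥)
    (htop : f x ≠ ⊤) (hlsc : ∀ᶠ y in 𝓝 x, LowerSemicontinuousAt f y) :
    ∃ xs vs : ℕ → V, (∀ i, vs i ∈ regularSubdifferential f (xs i)) ∧
      Tendsto xs atTop (𝓝 x) ∧ Tendsto (fun i => f (xs i)) atTop (𝓝 (f x)) := by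
  have : ProperSpace V := FiniteDimensional.proper ℝ V
  obtain ⟨r, hr, hball⟩ := Metric.nhds_basis_closedBall.eventually_iff.1 hlsc
  have hK : IsCompact (Metric.closedBall x r) := isCompact_closedBall x r
  have hxK : x ∈ Metric.closedBall x r := Metric.mem_closedBall_self hr.le
  obtain ⟨p, -, hp⟩ := LowerSemicontinuousOn.exists_isMinOn ⟨x, hxK⟩ hK
    (fun y hy => (hball hy).lowerSemicontinuousWithinAt _ : LowerSemicontinuousOn f _)
  -- As the penalty weight `j` grows, the minimizers are driven to `x`.
  have hmin : ∀ j : ℕ, ∃ y ∈ Metric.closedBall x r, ∀ z ∈ Metric.closedBall x r,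
      f y + ((j * ‖y - x‖ ^ 2 : ℝ) : EReal) ≤ f z + ((j * ‖z - x‖ ^ 2 : ℝ) : EReal) := by
    intro j
    have hcont : Continuous fun y => ((j * ‖y - x‖ ^ 2 : ℝ) : EReal) :=
      continuous_coe_real_ereal.comp (by fun_prop)
    have h : LowerSemicontinuousOn (fun y => f y + ((j * ‖y - x‖ ^ 2 : ℝ) : EReal))
        (Metric.closedBall x r) := fun y hy =>
      ((hball hy).lowerSemicontinuousWithinAt _).add'
        (hcont.lowerSemicontinuous.lowerSemicontinuousAt y |>.lowerSemicontinuousWithinAt _)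
        (EReal.continuousAt_add (.inr (EReal.coe_ne_bot _)) (.inr (EReal.coe_ne_top _)))
    obtain ⟨y, hy, hy'⟩ := LowerSemicontinuousOn.exists_isMinOn ⟨x, hxK⟩ hK h
    exact ⟨y, hy, hy'⟩
  choose y hyK hy using hmin
  have hreal : ∀ z, f z ≤ f x → ((f z).toReal : EReal) = f z := fun z hz =>
    EReal.coe_toReal (hz.trans_lt htop.lt_top).ne (hbot z)
  have hyx : ∀ j, f (y j) + ((j * ‖y j - x‖ ^ 2 : ℝ) : EReal) ≤ f x := fun j => by
    simpa using hy j x hxK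
  have hyle : ∀ j, f (y j) ≤ f x := fun j => by
    refine le_trans ?_ (hyx j)
    refine le_add_of_nonneg_right ?_
    exact_mod_cast (by positivity : (0 : ℝ) ≤ j * ‖y j - x‖ ^ 2)
  have hpx : f p ≤ f x := hp hxK
  have hineq : ∀ j : ℕ, (f p).toReal + j * ‖y j - x‖ ^ 2 ≤ (f x).toReal := by
    intro j
    have h1 : f p + ((j * ‖y j - x‖ ^ 2 : ℝ) : EReal) ≤ f x :=
      le_trans (add_le_add_left (hp (hyK j)) _) (hyx j)
    rw [← hreal p hpx, ← hreal x le_rfl] at h1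
    exact_mod_cast h1
  have hytend : Tendsto y atTop (𝓝 x) := by
    rw [tendsto_iff_norm_sub_tendsto_zero]
    have hsq : Tendsto (fun j => ‖y j - x‖ ^ 2) atTop (𝓝 0) := by
      refine tendsto_of_tendsto_of_tendsto_of_le_of_le' tendsto_const_nhds
        (tendsto_const_div_atTop_nhds_zero_nat ((f x).toReal - (f p).toReal))
        (Eventually.of_forall fun _ => sq_nonneg _) ?_
      filter_upwards [eventually_gt_atTop 0] with j hj
      have : (0 : ℝ) < j := by exact_mod_cast hj
      rw [le_div_iff₀ this]
      linarith [hineq j]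
    have := hsq.sqrt
    simpa [Real.sqrt_sq] using this
  have hftend : Tendsto (fun j => f (y j)) atTop (𝓝 (f x)) :=
    tendsto_order.2 ⟨fun a ha => hytend.eventually (hball hxK a ha),
      fun a ha => Eventually.of_forall fun j => (hyle j).trans_lt ha⟩
  -- The subgradient is minus the gradient of the penalty. Once `y j` is in the open ball, all
  -- nearby `z` compete in the minimization, and the quadratic error `j * ‖z - y j‖ ^ 2` is absorbed
  -- by `ε * ‖z - y j‖`.
  have hsub : ∀ᶠ j in atTop, (-(2 * j) : ℝ) • (y j - x) ∈ regularSubdifferential f (y j) := by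
    filter_upwards [hytend.eventually (Metric.ball_mem_nhds x hr)] with j hj
    refine ⟨hbot _, ((hyle j).trans_lt htop.lt_top).ne, fun ε hε => ?_⟩
    have hnorm : ∀ᶠ z in 𝓝 (y j), j * ‖z - y j‖ < ε := by
      have : Tendsto (fun z => (j : ℝ) * ‖z - y j‖) (𝓝 (y j)) (𝓝 (j * ‖y j - y j‖)) :=
        Continuous.tendsto (by fun_prop) _
      rw [sub_self, norm_zero, mul_zero] at this
      exact this.eventually (gt_mem_nhds hε)
    filter_upwards [hnorm, Metric.isOpen_ball.mem_nhds hj] with z hz hzb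
    by_cases hzt : f z = ⊤
    · rw [hzt]; exact le_top
    have h1 := hy j z (Metric.ball_subset_closedBall hzb)
    rw [← hreal _ (hyle j), ← EReal.coe_toReal hzt (hbot z)] at h1
    rw [← EReal.coe_toReal hzt (hbot z)]
    have h2 : (f (y j)).toReal + j * ‖y j - x‖ ^ 2 ≤ (f z).toReal + j * ‖z - x‖ ^ 2 := by
      exact_mod_cast h1
    rw [EReal.coe_le_coe_iff, inner_smul_left]
    have h3 : ‖z - x‖ ^ 2 = ‖y j - x‖ ^ 2 + 2 * inner ℝ (y j - x) (z - y j) + ‖z - y j‖ ^ 2 := by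
      rw [← norm_add_sq_real]
      congr 2
      abel
    have h4 : j * ‖z - y j‖ ^ 2 ≤ ε * ‖z - y j‖ := by
      rw [pow_two, ← mul_assoc]
      exact mul_le_mul_of_nonneg_right hz.le (norm_nonneg _)
    rw [h3] at h2
    simp only [conj_trivial]
    linarith
  obtain ⟨N, hN⟩ := eventually_atTop.1 hsub
  exact ⟨fun i => y (i + N), _, fun i => hN (i + N) (by omega),
    hytend.comp (tendsto_add_atTop_nat N), hftend.comp (tendsto_add_atTop_nat N)⟩

/-- The horizon subdifferential contains `0` where the function is finite and locally lower
semicontinuous. -/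
theorem zero_mem_horizonSubdifferential [FiniteDimensional ℝ V] (hbot : ∀ y, f y ≠ ⊥)
    (htop : f x ≠ ⊤) (hlsc : ∀ᶠ y in 𝓝 x, LowerSemicontinuousAt f y) :
    (0 : V) ∈ horizonSubdifferential f x := by
  obtain ⟨xs, vs, hvs, hxs, hfs⟩ := exists_seq_regularSubdifferential hbot htop hlsc
  have hτ : Tendsto (fun i : ℕ => 1 / ((i : ℝ) + 1)) atTop (𝓝 0) :=
    tendsto_one_div_add_atTop_nhds_zero_nat
  have hpos : ∀ i, 0 < 1 + ‖vs i‖ := fun i => by positivity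
  -- The factor `1 + ‖vs i‖` makes both `τ i` and `τ i • vs i` at most `1 / (i + 1)` in norm, even
  -- if `vs` is unbounded.
  refine ⟨hbot x, htop, xs, vs, fun i => 1 / ((i : ℝ) + 1) / (1 + ‖vs i‖), hvs,
    fun i => by positivity, ?_, hxs, hfs, ?_⟩
  · refine squeeze_zero (fun i => by positivity) (fun i => ?_) hτ
    exact div_le_self (by positivity) (by linarith [norm_nonneg (vs i)])
  · refine squeeze_zero_norm (fun i => ?_) hτ
    rw [norm_smul, Real.norm_of_nonneg (by positivity), div_mul_eq_mul_div, div_le_iff₀ (hpos i)]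
    exact mul_le_mul_of_nonneg_left (by linarith) (by positivity)

end Subdifferential

/-! ### Invariant functions: passing to the limit -/

section Invariant

variable {E V G : Type*} [NormedAddCommGroup E] [NormedSpace ℝ E]
  [NormedAddCommGroup V] [InnerProductSpace ℝ V]
  [Group G] [TopologicalSpace G] [ChartedSpace E G] [LieGroup 𝓘(ℝ, E) 1 G]
  [MulAction G V] [ContMDiffSMul 𝓘(ℝ, E) 𝓘(ℝ, V) 1 G V] {f : V → EReal}

/-- Regular subgradients of invariant functions are orthogonal to the infinitesimal generators. -/
theorem regularSubdifferential.inner_fderiv_orbit_eq_zero (hinv : ∀ (g : G) (x : V), f (g • x) = f x)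
    {x v : V} (hv : v ∈ regularSubdifferential f x) (u : E) :
    inner ℝ v (fderiv ℝ (fun v => (extChartAt 𝓘(ℝ, E) (1 : G)).symm v • x)
      (extChartAt 𝓘(ℝ, E) (1 : G) 1) u) = 0 := by
  set a := extChartAt 𝓘(ℝ, E) (1 : G) 1 with ha
  have hline : HasDerivAt (fun t : ℝ => a + t • u) u 0 := by
    simpa using ((hasDerivAt_id (0 : ℝ)).smul_const u).const_add a
  refine regularSubdifferential.inner_eq_zero hv
    (η := fun t : ℝ => (extChartAt 𝓘(ℝ, E) (1 : G)).symm (a + t • u) • x) ?_ ?_ ?_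
  · refine HasFDerivAt.comp_hasDerivAt (f := fun t : ℝ => a + t • u)
      (l := fun v => (extChartAt 𝓘(ℝ, E) (1 : G)).symm v • x) 0 ?_ hline
    rw [zero_smul, add_zero]
    exact ((contDiffAt_extChartAt_symm_smul_left (mem_extChartAt_target _) x).differentiableAt
      one_ne_zero).hasFDerivAt
  · simp [ha]
  · exact Eventually.of_forall fun t => hinv _ _

/-- The generator at `y` is a partial derivative of the jointly `C^1` action map. This allows the
base point to vary in the limit of subgradients. -/
theorem continuousAt_fderiv_orbit (u : E) (x : V) :
    ContinuousAt (fun y => fderiv ℝ (fun v => (extChartAt 𝓘(ℝ, E) (1 : G)).symm v • y)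
      (extChartAt 𝓘(ℝ, E) (1 : G) 1) u) x := by
  set c := extChartAt 𝓘(ℝ, E) (1 : G) with hc
  have hΦ : ∀ y, ContDiffAt ℝ 1 (fun p : E × V => c.symm p.1 • p.2) (c 1, y) := fun y =>
    contDiffAt_extChartAt_symm_smul (mem_extChartAt_target _) y
  have heq : ∀ y, fderiv ℝ (fun v => c.symm v • y) (c 1) u =
      fderiv ℝ (fun p : E × V => c.symm p.1 • p.2) (c 1, y) (u, 0) := by
    intro y
    have h := HasFDerivAt.comp (f := fun v : E => (v, y)) (c 1)
      ((hΦ y).differentiableAt one_ne_zero).hasFDerivAt (hasFDerivAt_prodMk_left (c 1) y)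
    exact congrArg (fun L => L u) h.fderiv
  simp only [heq]
  have h1 : ContinuousAt (fderiv ℝ (fun p : E × V => c.symm p.1 • p.2)) (c 1, x) :=
    ((hΦ x).fderiv_right (m := 0) le_rfl).continuousAt
  have h2 : ContinuousAt (fun y : V => (c 1, y)) x := by fun_prop
  exact (ContinuousAt.comp (f := fun y : V => (c 1, y)) h1 h2).clm_apply continuousAt_const

/-- Limits of multiples of regular subgradients of invariant functions are orthogonal to the
infinitesimal generators. -/
theorem inner_fderiv_orbit_eq_zero_of_tendsto (hinv : ∀ (g : G) (x : V), f (g • x) = f x)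
    {x v : V} {xs vs : ℕ → V} {τ : ℕ → ℝ} (hvs : ∀ i, vs i ∈ regularSubdifferential f (xs i))
    (hxs : Tendsto xs atTop (𝓝 x)) (hv : Tendsto (fun i => τ i • vs i) atTop (𝓝 v)) (u : E) :
    inner ℝ v (fderiv ℝ (fun v => (extChartAt 𝓘(ℝ, E) (1 : G)).symm v • x)
      (extChartAt 𝓘(ℝ, E) (1 : G) 1) u) = 0 := by
  refine tendsto_nhds_unique (hv.inner ((continuousAt_fderiv_orbit (G := G) u x).tendsto.comp hxs))
    (tendsto_const_nhds.congr fun i => ?_)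
  rw [inner_smul_left, Function.comp,
    regularSubdifferential.inner_fderiv_orbit_eq_zero hinv (hvs i), mul_zero]

/-- Arbitrary scalars `τ` serve both subdifferentials: `τ = 1` for the limiting one, `τ → 0` for the
horizon one. -/
theorem starProjection_eq_zero_of_tendsto [FiniteDimensional ℝ E] [FiniteDimensional ℝ V]
    [SecondCountableTopology G] (k : ℕ∞) (hinv : ∀ (g : G) (x : V), f (g • x) = f x)
    {x v : V} (hx : ProperActionNear G x)
    {xs vs : ℕ → V} {τ : ℕ → ℝ} (hvs : ∀ i, vs i ∈ regularSubdifferential f (xs i))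
    (hxs : Tendsto xs atTop (𝓝 x)) (hv : Tendsto (fun i => τ i • vs i) atTop (𝓝 v)) :
    (submanifoldTangentSpace k (MulAction.orbit G x) x).starProjection v = 0 := by
  rw [Submodule.starProjection_apply_eq_zero_iff, Submodule.mem_orthogonal']
  intro w hw
  -- The generators form a subspace, so containing the velocities they contain their span.
  obtain ⟨u, rfl⟩ := Submodule.span_le.2 (curveVelocities_orbit_subset (E := E) hx) hw
  exact inner_fderiv_orbit_eq_zero_of_tendsto hinv hvs hxs hv u

end Invariant

theorem mainTheorem1 {n m : ℕ} (k : ℕ∞) (hk : 1 ≤ k)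
    {G : Type*} [Group G] [TopologicalSpace G] [T2Space G] [SecondCountableTopology G]
    [ChartedSpace (EuclideanSpace ℝ (Fin m)) G] [LieGroup (𝓡 m) k G]
    [MulAction G (EuclideanSpace ℝ (Fin n))]
    [ContMDiffSMul (𝓡 m) (𝓡 n) k G (EuclideanSpace ℝ (Fin n))]
    (f : EuclideanSpace ℝ (Fin n) → EReal) (hbot : ∀ x, f x ≠ ⊥)
    (hinv : ∀ (g : G) (x : EuclideanSpace ℝ (Fin n)), f (g • x) = f x)
    (x₀ : EuclideanSpace ℝ (Fin n)) (hdom : f x₀ < ⊤)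
    (htyp : TypicalActionAt G x₀) :
    (submanifoldTangentSpace k (MulAction.orbit G x₀) x₀).starProjection ''
        limitingSubdifferential f x₀ ⊆ {0} ∧
    (submanifoldTangentSpace k (MulAction.orbit G x₀) x₀).starProjection ''
        horizonSubdifferential f x₀ ⊆ {0} ∧
    ((∀ᶠ x in 𝓝 x₀, LowerSemicontinuousAt f x) →
      (submanifoldTangentSpace k (MulAction.orbit G x₀) x₀).starProjection ''
        horizonSubdifferential f x₀ = {0}) := by
  have hk' : (1 : WithTop ℕ∞) ≤ k := by exact_mod_cast hk
  have : LieGroup (𝓡 m) 1 G := LieGroup.of_le hk'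
  have : ContMDiffSMul (𝓡 m) (𝓡 n) 1 G (EuclideanSpace ℝ (Fin n)) := ContMDiffSMul.of_le hk'
  have hhor : (submanifoldTangentSpace k (MulAction.orbit G x₀) x₀).starProjection ''
      horizonSubdifferential f x₀ ⊆ {0} := by
    rintro _ ⟨v, ⟨-, -, xs, vs, τ, hvs, -, -, hxs, -, hv⟩, rfl⟩
    exact starProjection_eq_zero_of_tendsto (E := EuclideanSpace ℝ (Fin m)) k hinv htyp.1 hvs hxs hv
  refine ⟨?_, hhor, fun hlsc => hhor.antisymm ?_⟩
  · rintro _ ⟨v, ⟨-, -, xs, vs, hvs, hxs, -, hv⟩, rfl⟩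
    exact starProjection_eq_zero_of_tendsto (E := EuclideanSpace ℝ (Fin m)) (τ := fun _ => 1) k
      hinv htyp.1 hvs hxs (by simpa using hv)
  · rintro _ rfl
    exact ⟨0, zero_mem_horizonSubdifferential hbot hdom.ne hlsc, map_zero _⟩
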